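/- Let $G$ be a finite connected undirected graph, possibly with loops and multiple edges, with $n$ vertices, $m$ edges and genus $g=m-n+1$. Let $T(x,y)=\sum_{S\subseteq E(G)}(x-1)^{r(E)-r(S)}(y-1)^{|S|-r(S)}$ be its Tutte polynomial, where $r(S)=n-c(S)$ and $c(S)$ is the number of connected components of the spanning subgraph $(V(G),S)$. Let $R(p)$ be the reliability polynomial of $G$, i.e. the probability that the remaining spanning subgraph is connected when each edge of $G$ is removed independently with probability $p$. A partial orientation of $G$ is an orientation of a subset of the edges (every edge, loops included, has two possible orientations). A directed cut of it is a cut $(X,X^c)$, with $X$ and $X^c$ non-empty, all of whose edges are oriented from $X$ to $X^c$. Fix any total order $<$ on $E(G)$ and any full reference orientation $A$ of $G$. A partial orientation is cut minimal (with respect to $(<,A)$) if in each of its directed cuts the $<$-minimum edge is oriented as in $A$. For positive integers $k,l$, a $(k,l)$-chromatic partial orientation is a partial orientation together with an assignment of one of $k$ colors to each oriented edge and one of $l$ colors to each unoriented edge; it is cut minimal if the underlying partial orientation is. Let $p$ be rational with $0<p<\tfrac12$. Then $p$ can be written as $p=\frac{k}{2k+l}$ with positive integers $k,l$, and $$R(p)=(1-p)^{n-1}p^{g}\,T\!\left(1,\tfrac1p\right).$$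 For all positive integers $k,l$ with $p=\frac{k}{2k+l}$, the number of cut minimal $(k,l)$-chromatic partial orientations of $G$ is $$(k+l)^{n-1}k^{g}\,T\!\left(1,\tfrac{2k+l}{k}\right),$$ and $R(p)$ equals the probability that a uniformly random $(k,l)$-chromatic partial orientation of $G$ is cut minimal. -/

import Mathlib

open scoped Graph

namespace TutteOrientation

noncomputable section

variable {α β : Type*}

/-! Graphs are Mathlib's multigraphs `Graph α β` (loops and parallel edges allowed), with vertex
set `V(G)` and edge set `E(G)`. -/

/-- The number `m` of edges. -/
def numEdges (G : Graph α β) : ℕ := Nat.card E(G)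

/-- The number `n` of vertices. -/
def numVertices (G : Graph α β) : ℕ := Nat.card V(G)

/-- The genus `g = m - n + 1` (a connected finite graph has `n ≤ m + 1`, so the subtraction of
natural numbers is the true one there). -/
def genus (G : Graph α β) : ℕ := numEdges G + 1 - numVertices G

/-- The adjacency relation between distinct vertices of the spanning subgraph of `G` whose edges
are those in `S`; it has the same connected components as this spanning subgraph. -/
def spanning (G : Graph α β) (S : Set E(G)) : SimpleGraph V(G) :=
  SimpleGraph.fromRel fun u v => ∃ e ∈ S, G.IsLink e u v

/-- `G` is connected (in particular it has a vertex). -/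
def IsConnected (G : Graph α β) : Prop := (spanning G Set.univ).Connected

/-- The number of connected components of the spanning subgraph with edge set `S`. -/
def numComponents (G : Graph α β) (S : Set E(G)) : ℕ :=
  Nat.card (spanning G S).ConnectedComponent

/-- The rank `r(S) = n - c(S)` of a set of edges. -/
def rank (G : Graph α β) (S : Set E(G)) : ℕ := numVertices G - numComponents G S

/-- The Tutte polynomial
`T(x, y) = ∑_{S ⊆ E} (x - 1)^(r(E) - r(S)) (y - 1)^(|S| - r(S))`; variable `0` is `x` and
variable `1` is `y`. -/
def tutte (G : Graph α β) [Fintype E(G)] : MvPolynomial (Fin 2) ℤ :=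
  ∑ S : Finset E(G),
    (MvPolynomial.X 0 - 1) ^ (rank G Set.univ - rank G (S : Set E(G))) *
      (MvPolynomial.X 1 - 1) ^ (S.card - rank G (S : Set E(G)))

/-- The value `T(x, y)` of the Tutte polynomial at rational numbers. -/
def tutteEval (G : Graph α β) [Fintype E(G)] (x y : ℚ) : ℚ :=
  MvPolynomial.aeval ![x, y] (tutte G)

open Classical in
/-- The reliability polynomial: its value at `p` is the probability that the spanning subgraph
that remains is connected when every edge is removed, independently, with probability `p`. -/
def reliability (G : Graph α β) [Fintype E(G)] : Polynomial ℚ :=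
  ∑ S : Finset E(G),
    if (spanning G (S : Set E(G))).Connected then
      (1 - Polynomial.X) ^ S.card * Polynomial.X ^ (Fintype.card E(G) - S.card)
    else 0

/-- A full orientation of `G`: every edge gets a tail and a head. -/
structure Orientation (G : Graph α β) where
  tail : E(G) → V(G)
  head : E(G) → V(G)
  isLink : ∀ e : E(G), G.IsLink e (tail e) (head e)

/-- A partial orientation of `G`, recorded relative to a fixed reference orientation `A`: the edge
`e` is oriented as in `A` if the value is `1`, oppositely to `A` if it is `-1`, and is
unoriented if it is `0`. In particular a loop, like every other edge, has two orientations. -/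
def PartialOrientation (G : Graph α β) : Type _ := E(G) → SignType

/-- In the partial orientation `O` (relative to `A`), the edge `e` is oriented from `u` to `v`. -/
def IsArc {G : Graph α β} (A : Orientation G) (O : PartialOrientation G)
    (e : E(G)) (u v : V(G)) : Prop :=
  (O e = 1 ∧ A.tail e = u ∧ A.head e = v) ∨ (O e = -1 ∧ A.head e = u ∧ A.tail e = v)

/-- The edges of the cut `(X, Xᶜ)`. -/
def cutEdges (G : Graph α β) (X : Set V(G)) : Set E(G) :=
  {e | ∃ u ∈ X, ∃ v ∉ X, G.IsLink e u v}

/-- `(X, Xᶜ)` is a directed cut of the partial orientation `O`, directed from `X` to `Xᶜ`: both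
sides are nonempty and every edge of the cut is oriented from `X` to `Xᶜ` (so none of them is
unoriented). -/
def IsDirectedCut {G : Graph α β} (A : Orientation G) (O : PartialOrientation G)
    (X : Set V(G)) : Prop :=
  X.Nonempty ∧ Xᶜ.Nonempty ∧ ∀ e ∈ cutEdges G X, ∃ u ∈ X, ∃ v ∉ X, IsArc A O e u v

/-- `O` is cut minimal with respect to the total order of the edges and the reference
orientation `A`: in every directed cut the minimum edge is oriented as in `A`. -/
def IsCutMinimal {G : Graph α β} [LinearOrder E(G)] (A : Orientation G)
    (O : PartialOrientation G) : Prop :=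
  ∀ X : Set V(G), IsDirectedCut A O X → ∀ e : E(G), IsLeast (cutEdges G X) e → O e = 1

/-- A `(k, l)`-chromatic partial orientation: a partial orientation in which every oriented edge
has one of `k` colors and every unoriented edge has one of `l` colors. -/
structure ChromaticPartialOrientation (G : Graph α β) (k l : ℕ) where
  orientation : PartialOrientation G
  color : ∀ e : E(G), Fin (if orientation e = 0 then l else k)

/-- The number of cut minimal `(k, l)`-chromatic partial orientations. -/
def numCutMinimal (G : Graph α β) [LinearOrder E(G)] (A : Orientation G) (k l : ℕ) : ℕ :=
  Nat.card {C : ChromaticPartialOrientation G k l // IsCutMinimal A C.orientation}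

/-- The probability that a uniformly random `(k, l)`-chromatic partial orientation is cut
minimal. -/
def probCutMinimal (G : Graph α β) [LinearOrder E(G)] (A : Orientation G) (k l : ℕ) : ℚ :=
  (numCutMinimal G A k l : ℚ) / (Nat.card (ChromaticPartialOrientation G k l) : ℚ)

end

end TutteOrientation

/-! Give each edge four possible states: `some 1` and `some (-1)` (oriented), `some 0` (unoriented)
and `none` (deleted). An unoriented edge keeps every cut through it from being directed, so it acts
as a contracted edge.

Fix the states of all edges but `e` and let `[s]` be the indicator of minimality when `e` has state
`s`. If no edge above `e` is oriented, then `[1] + [-1] = [0] + [none]`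
(`indicator_update_pos_add_neg`); the main difficulty is that `[0]` forces `[1]` or `[-1]`, which
follows by uncrossing two cuts (`exists_outCut_not_crosses`). Hence `k[1] + k[-1] + l[0] = (k+l)[0]
+ k[none]`. Trading weights edge by edge, from the largest down (`minimalConfigSum_insert`), removes
all orientations and leaves the sum of `(k+l)^|S| k^(m-|S|)` over the connected spanning edge sets
`S` (`connectedSum`).

At `x = 1` the Tutte sum also retains only connected `S`, and dividing by the total `(2k+l)^m` turns
the weights `k+l` and `k` into `1-p` and `p`. -/

namespace TutteOrientation

/-! ### Directed cuts and uncrossing. -/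

section Cuts

variable {V E : Type*}

/-- The edge `e` joins `X` to its complement. -/
def Crosses (tail head : E → V) (X : Set V) (e : E) : Prop :=
  ¬ (tail e ∈ X ↔ head e ∈ X)

/-- The edge `e`, oriented by `s` relative to `(tail, head)`, leaves `X`. -/
def Leaves (tail head : E → V) (s : Option SignType) (X : Set V) (e : E) : Prop :=
  (s = some 1 ∧ tail e ∈ X ∧ head e ∉ X) ∨ (s = some (-1) ∧ head e ∈ X ∧ tail e ∉ X)

/-- Both sides of the cut of `X` are nonempty and every edge of it that is not deleted
(deleted edges have the value `none`) is oriented out of `X`. -/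
def IsOutCut (tail head : E → V) (c : E → Option SignType) (X : Set V) : Prop :=
  X.Nonempty ∧ Xᶜ.Nonempty ∧
    ∀ e, c e ≠ none → Crosses tail head X e → Leaves tail head (c e) X e

/-- Among the edges of the cut of `X` that are not deleted there is a least one, and it has the
reference orientation. -/
def HasPositiveMin [LinearOrder E] (tail head : E → V) (c : E → Option SignType) (X : Set V) :
    Prop :=
  ∃ e, c e = some 1 ∧ Crosses tail head X e ∧ ∀ f, Crosses tail head X f → c f ≠ none → e ≤ f

/-- Every directed cut of the configuration `c` has a minimum edge with the reference
orientation. In particular the edges that are not deleted form a connected graph. -/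
def IsMinimalConfig [LinearOrder E] (tail head : E → V) (c : E → Option SignType) : Prop :=
  ∀ X : Set V, IsOutCut tail head c X → HasPositiveMin tail head c X

variable {tail head : E → V}

theorem Crosses.of_inter {X Y : Set V} {e : E} (h : Crosses tail head (X ∩ Y) e) :
    Crosses tail head X e ∨ Crosses tail head Y e := by
  simp only [Crosses, Set.mem_inter_iff] at *; tauto

theorem Crosses.of_union {X Y : Set V} {e : E} (h : Crosses tail head (X ∪ Y) e) :
    Crosses tail head X e ∨ Crosses tail head Y e := by
  simp only [Crosses, Set.mem_union] at *; tauto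

theorem Leaves.inter {s : Option SignType} {X Y : Set V} {e : E}
    (hX : Crosses tail head X e → Leaves tail head s X e)
    (hY : Crosses tail head Y e → Leaves tail head s Y e)
    (h : Crosses tail head (X ∩ Y) e) : Leaves tail head s (X ∩ Y) e := by
  simp only [Crosses, Leaves, Set.mem_inter_iff] at *
  by_cases h1 : tail e ∈ X <;> by_cases h2 : head e ∈ X <;> by_cases h3 : tail e ∈ Y <;>
    by_cases h4 : head e ∈ Y <;> simp_all

theorem Leaves.union {s : Option SignType} {X Y : Set V} {e : E}
    (hX : Crosses tail head X e → Leaves tail head s X e)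
    (hY : Crosses tail head Y e → Leaves tail head s Y e)
    (h : Crosses tail head (X ∪ Y) e) : Leaves tail head s (X ∪ Y) e := by
  simp only [Crosses, Leaves, Set.mem_union] at *
  by_cases h1 : tail e ∈ X <;> by_cases h2 : head e ∈ X <;> by_cases h3 : tail e ∈ Y <;>
    by_cases h4 : head e ∈ Y <;> simp_all

theorem Crosses.inter_or_union {s : Option SignType} {X Y : Set V} {e : E}
    (hX : Crosses tail head X e → Leaves tail head s X e)
    (hY : Crosses tail head Y e → Leaves tail head s Y e)
    (h : Crosses tail head X e ∨ Crosses tail head Y e) :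
    Crosses tail head (X ∩ Y) e ∨ Crosses tail head (X ∪ Y) e := by
  simp only [Crosses, Leaves, Set.mem_inter_iff, Set.mem_union] at *
  by_cases h1 : tail e ∈ X <;> by_cases h2 : head e ∈ X <;> by_cases h3 : tail e ∈ Y <;>
    by_cases h4 : head e ∈ Y <;> simp_all

variable [LinearOrder E]

/-- Uncrossing: if two directed cuts contain `e` in opposite directions and neither has a positive
minimum, then some directed cut without a positive minimum avoids `e`. -/
theorem exists_outCut_not_crosses [Finite E] {c c' : E → Option SignType} {X Y : Set V} {e : E}
    (hcc : ∀ f, f ≠ e → c f = c' f) (hmax : ∀ f, e < f → ∀ Z, ¬ Leaves tail head (c f) Z f)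
    (hXe : tail e ∈ X ∧ head e ∉ X) (hYe : head e ∈ Y ∧ tail e ∉ Y)
    (hX : IsOutCut tail head c X) (hY : IsOutCut tail head c' Y)
    (hXmin : ¬ HasPositiveMin tail head c X) (hYmin : ¬ HasPositiveMin tail head c' Y)
    (hce : c e = some 1) :
    ∃ Z, (tail e ∈ Z ↔ head e ∈ Z) ∧ IsOutCut tail head c Z ∧ ¬ HasPositiveMin tail head c Z := by
  have hout : ∀ f, f ≠ e → c f ≠ none →
      (Crosses tail head X f → Leaves tail head (c f) X f) ∧
      (Crosses tail head Y f → Leaves tail head (c f) Y f) := fun f hf hn =>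
    ⟨hX.2.2 f hn, by rw [hcc f hf]; exact hY.2.2 f (hcc f hf ▸ hn)⟩
  -- the undeleted edges other than `e` in the two cuts
  let S : Set E := {f | f ≠ e ∧ c f ≠ none ∧ (Crosses tail head X f ∨ Crosses tail head Y f)}
  have hlt : ∀ f ∈ S, f < e := by
    rintro f ⟨hf, hn, h⟩
    refine lt_of_le_of_ne (not_lt.1 fun hlt => ?_) hf
    rcases h with h | h
    · exact hmax f hlt _ ((hout f hf hn).1 h)
    · exact hmax f hlt _ ((hout f hf hn).2 h)
  -- Otherwise `e` is the only undeleted edge in the cut of `X`, hence its positive minimum.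
  have hS : S.Nonempty := by
    by_contra hne
    refine hXmin ⟨e, hce, by simp [Crosses, hXe], fun f hf hn => ?_⟩
    by_contra hlt
    exact hne ⟨f, fun h => hlt (h ▸ le_rfl), hn, Or.inl hf⟩
  obtain ⟨f, hfS, hfmin⟩ := S.toFinite.exists_minimal hS |>.imp fun f hf =>
    (⟨hf.prop, fun g hg => (le_total f g).elim id fun h => hf.le_of_le hg h⟩ :
      f ∈ S ∧ ∀ g ∈ S, f ≤ g)
  obtain ⟨hfe, hfn, hf⟩ := hfS
  have hfle := hlt f ⟨hfe, hfn, hf⟩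
  -- `f` is below `e` and all other undeleted edges of both cuts, so if positive it would be the
  -- positive minimum of a cut containing it.
  have hf1 : c f ≠ some 1 := by
    intro h1
    rcases hf with h | h
    · refine hXmin ⟨f, h1, h, fun g hg hn => ?_⟩
      by_cases hge : g = e
      · exact hge ▸ hfle.le
      · exact hfmin g ⟨hge, hn, Or.inl hg⟩
    · refine hYmin ⟨f, hcc f hfe ▸ h1, h, fun g hg hn => ?_⟩
      by_cases hge : g = e
      · exact hge ▸ hfle.le
      · exact hfmin g ⟨hge, by rwa [hcc g hge], Or.inr hg⟩
  have key : ∀ Z, ((tail e ∈ Z) ↔ (head e ∈ Z)) → Crosses tail head Z f →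
      (∀ g, Crosses tail head Z g → Crosses tail head X g ∨ Crosses tail head Y g) →
      ¬ HasPositiveMin tail head c Z := by
    rintro Z hZe hZf hZ ⟨g, hg1, hgZ, hgmin⟩
    have hge : g ≠ e := by rintro rfl; exact hgZ hZe
    have h1 := hgmin f hZf hfn
    have h2 := hfmin g ⟨hge, by simp [hg1], hZ g hgZ⟩
    exact hf1 (le_antisymm h2 h1 ▸ hg1)
  have hcase : Crosses tail head (X ∩ Y) f ∨ Crosses tail head (X ∪ Y) f := by
    obtain ⟨h1, h2⟩ := hout f hfe hfn
    exact Crosses.inter_or_union h1 h2 hf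
  -- `e` joins `X \ Y` to `Y \ X`, so it crosses neither `X ∩ Y` nor `X ∪ Y`.
  rcases hcase with h | h
  · refine ⟨X ∩ Y, by simp [hXe, hYe], ⟨?_, ⟨head e, by simp [hXe]⟩, fun g hn hg => ?_⟩,
      key _ (by simp [hXe, hYe]) h fun g => Crosses.of_inter⟩
    · simp only [Crosses] at h
      by_contra hne
      rw [Set.not_nonempty_iff_eq_empty] at hne
      simp [hne] at h
    · have hge : g ≠ e := by rintro rfl; simp [Crosses, hXe, hYe] at hg
      obtain ⟨h1, h2⟩ := hout g hge hn
      exact Leaves.inter h1 h2 hg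
  · refine ⟨X ∪ Y, by simp [hXe, hYe], ⟨⟨tail e, by simp [hXe]⟩, ?_, fun g hn hg => ?_⟩,
      key _ (by simp [hXe, hYe]) h fun g => Crosses.of_union⟩
    · simp only [Crosses] at h
      by_contra hne
      rw [Set.not_nonempty_iff_eq_empty, Set.compl_empty_iff] at hne
      simp [hne] at h
    · have hge : g ≠ e := by rintro rfl; simp [Crosses, hXe, hYe] at hg
      obtain ⟨h1, h2⟩ := hout g hge hn
      exact Leaves.union h1 h2 hg

end Cuts

/-! ### The deletion-contraction identity at the largest oriented edge. -/

section Recursion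

variable {V E : Type*} {tail head : E → V}

theorem IsOutCut.congr {c c' : E → Option SignType} {X : Set V}
    (h : IsOutCut tail head c X) (hcc : ∀ f, Crosses tail head X f → c f = c' f) :
    IsOutCut tail head c' X :=
  ⟨h.1, h.2.1, fun f hn hf => hcc f hf ▸ h.2.2 f (by rwa [hcc f hf]) hf⟩

theorem crosses_compl {X : Set V} {e : E} : Crosses tail head Xᶜ e ↔ Crosses tail head X e := by
  simp [Crosses, not_iff_not]

variable [LinearOrder E]

theorem HasPositiveMin.congr {c c' : E → Option SignType} {X : Set V}
    (h : HasPositiveMin tail head c X) (hcc : ∀ f, Crosses tail head X f → c f = c' f) :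
    HasPositiveMin tail head c' X := by
  obtain ⟨g, hg, hgX, hmin⟩ := h
  exact ⟨g, hcc g hgX ▸ hg, hgX, fun f hf hn => hmin f hf (by rwa [hcc f hf])⟩

theorem IsMinimalConfig.hasPositiveMin_of_not_crosses {c c' : E → Option SignType} {X : Set V}
    (hc : IsMinimalConfig tail head c) (hX : IsOutCut tail head c' X)
    (hcc : ∀ f, Crosses tail head X f → c f = c' f) : HasPositiveMin tail head c' X :=
  (hc X (hX.congr fun f hf => (hcc f hf).symm)).congr hcc

open Function (update)

variable {c : E → Option SignType} {e : E}

theorem update_eq_update_of_ne (s t : Option SignType) {f : E} (hf : f ≠ e) :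
    update c e s f = update c e t f := by
  simp [Function.update_of_ne hf]

/-- Deleting the largest oriented edge `e` only loses directed cuts. -/
theorem IsMinimalConfig.of_update_none (hmax : ∀ f, e < f → c f = none ∨ c f = some 0)
    (h : IsMinimalConfig tail head (update c e none)) (s : Option SignType) :
    IsMinimalConfig tail head (update c e s) := by
  intro X hX
  have hX' : IsOutCut tail head (update c e none) X := by
    refine ⟨hX.1, hX.2.1, fun f hn hf => ?_⟩
    have hfe : f ≠ e := by rintro rfl; simp at hn
    rw [update_eq_update_of_ne none s hfe] at hn ⊢
    exact hX.2.2 f hn hf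
  obtain ⟨g, hg, hgX, hmin⟩ := h X hX'
  have hge : g ≠ e := by rintro rfl; simp at hg
  refine ⟨g, by rwa [update_eq_update_of_ne s none hge], hgX, fun f hf hn => ?_⟩
  by_cases hfe : f = e
  · subst hfe
    -- `g` is oriented and no edge above `e` is, so `g ≤ e`.
    by_contra hlt
    rw [Function.update_of_ne hge] at hg
    rcases hmax g (not_le.1 hlt) with h | h <;> simp [h] at hg
  · exact hmin f hf (by rwa [update_eq_update_of_ne none s hfe])

omit [LinearOrder E] in
theorem IsOutCut.not_crosses_of_eq_zero {c : E → Option SignType} {X : Set V}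
    (hX : IsOutCut tail head c X) {f : E} (hf : c f = some 0) : ¬ Crosses tail head X f := by
  intro h
  have := hX.2.2 f (by simp [hf]) h
  simp [Leaves, hf] at this

/-- A directed cut cannot contain the unoriented edge `e`, so the state of `e` does not affect it.
-/
theorem IsMinimalConfig.update_zero {s : Option SignType}
    (h : IsMinimalConfig tail head (update c e s)) :
    IsMinimalConfig tail head (update c e (some 0)) := by
  intro X hX
  refine h.hasPositiveMin_of_not_crosses hX fun f hf => update_eq_update_of_ne _ _ ?_
  rintro rfl
  exact hX.not_crosses_of_eq_zero (by simp) hf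

/-- A directed cut through the deleted `e` stays directed when `e` is restored pointing outwards.
Its positive minimum then also serves the deleted configuration, unless it is `e` itself. -/
theorem IsMinimalConfig.update_none (hmax : ∀ f, e < f → c f = none ∨ c f = some 0)
    (hpos : IsMinimalConfig tail head (update c e (some 1)))
    (hneg : IsMinimalConfig tail head (update c e (some (-1)))) :
    IsMinimalConfig tail head (update c e none) := by
  intro X hX
  have hout : ∀ f, f ≠ e → ∀ s, update c e s f ≠ none → Crosses tail head X f →
      Leaves tail head (update c e s f) X f := fun f hf s hn h => by
    rw [update_eq_update_of_ne s none hf] at hn ⊢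
    exact hX.2.2 f hn h
  by_cases hXe : Crosses tail head X e
  · by_cases ht : tail e ∈ X
    · have hh : head e ∉ X := fun hh => hXe (by tauto)
      have hX1 : IsOutCut tail head (update c e (some 1)) X := by
        refine ⟨hX.1, hX.2.1, fun f hn hf => ?_⟩
        by_cases hfe : f = e
        · subst hfe; simp [Leaves, ht, hh]
        · exact hout f hfe _ hn hf
      obtain ⟨g, hg, hgX, hmin⟩ := hpos X hX1
      by_cases hge : g = e
      · -- then `e` is the only edge of the cut
        subst hge
        -- The other undeleted edges of the cut would be oriented and above `g`, which `hmax`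
        -- excludes. So reversing `g` makes `Xᶜ` a directed cut whose only edge is negative.
        have honly : ∀ f, f ≠ g → Crosses tail head X f → c f = none := by
          intro f hf hfX
          by_contra hn
          rw [← Function.update_of_ne hf (some 1) c] at hn
          have h1 := hout f hf _ hn hfX
          rw [Function.update_of_ne hf] at h1
          rcases hmax f (lt_of_le_of_ne (hmin f hfX hn) hf.symm) with h | h <;>
            simp [h, Leaves] at h1
        have hXc : IsOutCut tail head (update c g (some (-1))) Xᶜ := by
          refine ⟨hX.2.1, by simpa using hX.1, fun f hn hf => ?_⟩
          by_cases hfe : f = g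
          · subst hfe; simp [Leaves, ht, hh]
          · rw [Function.update_of_ne hfe] at hn
            exact absurd (honly f hfe (crosses_compl.1 hf)) hn
        obtain ⟨a, ha, haX, -⟩ := hneg _ hXc
        have hag : a ≠ g := by rintro rfl; simp at ha
        rw [Function.update_of_ne hag, honly a hag (crosses_compl.1 haX)] at ha
        simp at ha
      · refine ⟨g, by rwa [update_eq_update_of_ne none (some 1) hge], hgX, fun f hf hn => ?_⟩
        have hfe : f ≠ e := by rintro rfl; simp at hn
        exact hmin f hf (by rwa [update_eq_update_of_ne _ none hfe])
    · have hh : head e ∈ X := by by_contra hh; exact hXe (by tauto)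
      have hX1 : IsOutCut tail head (update c e (some (-1))) X := by
        refine ⟨hX.1, hX.2.1, fun f hn hf => ?_⟩
        by_cases hfe : f = e
        · subst hfe; simp [Leaves, ht, hh]
        · exact hout f hfe _ hn hf
      obtain ⟨g, hg, hgX, hmin⟩ := hneg X hX1
      have hge : g ≠ e := by rintro rfl; simp at hg
      refine ⟨g, by rwa [update_eq_update_of_ne none (some (-1)) hge], hgX, fun f hf hn => ?_⟩
      have hfe : f ≠ e := by rintro rfl; simp at hn
      exact hmin f hf (by rwa [update_eq_update_of_ne _ none hfe])
  · refine hpos.hasPositiveMin_of_not_crosses hX fun f hf => update_eq_update_of_ne _ _ ?_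
    rintro rfl
    exact hXe hf

/-- If both orientations fail, the two bad cuts contain `e` in opposite directions. Uncrossing them
gives a bad cut avoiding `e`, which is still bad when `e` is unoriented. -/
theorem IsMinimalConfig.update_pos_or_neg [Finite E]
    (hmax : ∀ f, e < f → c f = none ∨ c f = some 0)
    (h : IsMinimalConfig tail head (update c e (some 0))) :
    IsMinimalConfig tail head (update c e (some 1)) ∨
      IsMinimalConfig tail head (update c e (some (-1))) := by
  by_contra! hcon
  obtain ⟨hpos, hneg⟩ := hcon
  simp only [IsMinimalConfig, not_forall] at hpos hneg
  obtain ⟨X, hX, hXmin⟩ := hpos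
  obtain ⟨Y, hY, hYmin⟩ := hneg
  have hcross : ∀ s Z, IsOutCut tail head (update c e s) Z →
      ¬ HasPositiveMin tail head (update c e s) Z → Crosses tail head Z e := by
    intro s Z hZ hZmin
    by_contra hcr
    exact hZmin (h.hasPositiveMin_of_not_crosses hZ fun f hf =>
      update_eq_update_of_ne _ _ (by rintro rfl; exact hcr hf))
  have h1 := hX.2.2 e (by simp) (hcross _ X hX hXmin)
  have h2 := hY.2.2 e (by simp) (hcross _ Y hY hYmin)
  simp only [Function.update_self, Leaves] at h1 h2
  obtain ⟨Z, hZe, hZ, hZmin⟩ := exists_outCut_not_crosses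
    (fun f hf => update_eq_update_of_ne (some 1) (some (-1)) hf)
    (fun f hf Z => by
      rw [Function.update_of_ne hf.ne']
      rcases hmax f hf with h | h <;> simp [h, Leaves])
    (by simpa using h1) (by simpa using h2) hX hY hXmin hYmin (by simp)
  exact hcross _ Z hZ hZmin hZe

open Classical in
/-- Deletion and contraction of the largest oriented edge. -/
theorem indicator_update_pos_add_neg [Finite E] (hmax : ∀ f, e < f → c f = none ∨ c f = some 0) :
    ((if IsMinimalConfig tail head (update c e (some 1)) then 1 else 0) +
        if IsMinimalConfig tail head (update c e (some (-1))) then 1 else 0 : ℚ) =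
      (if IsMinimalConfig tail head (update c e (some 0)) then 1 else 0) +
        if IsMinimalConfig tail head (update c e none) then 1 else 0 := by
  -- Together the implications say that `[none]` is the conjunction of `[1]` and `[-1]`, and `[0]`
  -- their disjunction.
  have h1 := IsMinimalConfig.update_none (tail := tail) (head := head) hmax
  have h2 := fun h => IsMinimalConfig.of_update_none (tail := tail) (head := head) hmax h (some 1)
  have h3 := fun h =>
    IsMinimalConfig.of_update_none (tail := tail) (head := head) hmax h (some (-1))
  have h4 := IsMinimalConfig.update_zero (tail := tail) (head := head) (c := c) (e := e)
    (s := some 1)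
  have h5 := IsMinimalConfig.update_zero (tail := tail) (head := head) (c := c) (e := e)
    (s := some (-1))
  have h6 := IsMinimalConfig.update_pos_or_neg (tail := tail) (head := head) hmax
  generalize IsMinimalConfig tail head (update c e (some 1)) = p at *
  generalize IsMinimalConfig tail head (update c e (some (-1))) = n at *
  generalize IsMinimalConfig tail head (update c e (some 0)) = z at *
  generalize IsMinimalConfig tail head (update c e none) = d at *
  by_cases p <;> by_cases n <;> by_cases z <;> by_cases d <;> simp_all

end Recursion

/-! ### Exchanging chromatic weights for subgraph weights. -/

section WeightedSum

/-- Fibring over the coordinates other than `a` reduces the comparison to one coordinate. -/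
theorem sum_eq_sum_of_sum_update {E σ M : Type*} [Fintype E] [DecidableEq E] [Fintype σ]
    [AddCommMonoid M] (a : E) {F G : (E → σ) → M}
    (h : ∀ c, ∑ s, F (Function.update c a s) = ∑ s, G (Function.update c a s)) :
    ∑ c, F c = ∑ c, G c := by
  have key : ∀ F : (E → σ) → M,
      ∑ c, F c = ∑ d : {j // j ≠ a} → σ, ∑ s, F ((Equiv.funSplitAt a σ).symm (s, d)) := by
    intro F
    rw [← (Equiv.funSplitAt a σ).symm.sum_comp F, Fintype.sum_prod_type_right]
  rcases isEmpty_or_nonempty σ with hσ | ⟨⟨s₀⟩⟩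
  · have : IsEmpty (E → σ) := ⟨fun c => hσ.false (c a)⟩
    simp
  rw [key F, key G]
  refine Finset.sum_congr rfl fun d _ => ?_
  have hupd : ∀ s, (Equiv.funSplitAt a σ).symm (s, d) =
      Function.update ((Equiv.funSplitAt a σ).symm (s₀, d)) a s := by
    intro s
    ext j
    by_cases hj : j = a
    · subst hj; simp [Equiv.funSplitAt, Equiv.piSplitAt]
    · simp [Equiv.funSplitAt, Equiv.piSplitAt, hj]
  have := h ((Equiv.funSplitAt a σ).symm (s₀, d))
  simpa only [← hupd] using this

/-- Weights of the states of an edge: oriented edges have weight `k`, others weight `l`. -/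
def chromaticWeight (k l : ℚ) : Option SignType → ℚ
  | none => 0
  | some s => if s = 0 then l else k

/-- Weights of the states of an edge: contracted edges have weight `k + l`, deleted edges have
weight `k`, and no edge is oriented. -/
def subgraphWeight (k l : ℚ) : Option SignType → ℚ
  | none => k
  | some s => if s = 0 then k + l else 0

variable {V E : Type*} [LinearOrder E] [Fintype E] (tail head : E → V) (k l : ℚ)

open Classical in
/-- The weighted number of minimal configurations, with the chromatic weights on the edges in `B`
and the subgraph weights on the others. -/
noncomputable def minimalConfigSum (B : Finset E) : ℚ :=
  ∑ c : E → Option SignType,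
    (∏ e, (if e ∈ B then chromaticWeight k l else subgraphWeight k l) (c e)) *
      if IsMinimalConfig tail head c then 1 else 0

theorem minimalConfigSum_insert {a : E} {B : Finset E} (ha : ∀ x ∈ B, x < a) :
    minimalConfigSum tail head k l (insert a B) = minimalConfigSum tail head k l B := by
  classical
  have haB : a ∉ B := fun h => (ha a h).false
  unfold minimalConfigSum
  refine sum_eq_sum_of_sum_update a fun c => ?_
  set w : E → Option SignType → ℚ :=
    fun e => if e ∈ B then chromaticWeight k l else subgraphWeight k l with hw
  have hprod : ∀ (w' : E → Option SignType → ℚ), (∀ e, e ≠ a → w' e = w e) → ∀ s,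
      ∏ e, w' e (Function.update c a s e) = w' a s * ∏ e ∈ Finset.univ.erase a, w e (c e) := by
    intro w' hw' s
    rw [← Finset.mul_prod_erase _ _ (Finset.mem_univ a), Function.update_self]
    congr 1
    refine Finset.prod_congr rfl fun e he => ?_
    rw [hw' e (Finset.ne_of_mem_erase he), Function.update_of_ne (Finset.ne_of_mem_erase he)]
  have h1 := hprod (fun e => if e ∈ insert a B then chromaticWeight k l else subgraphWeight k l)
    (fun e he => by simp [hw, he])
  have h2 : ∀ s, ∏ e, (if e ∈ B then chromaticWeight k l else subgraphWeight k l)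
      (Function.update c a s e) = _ := hprod w fun _ _ => rfl
  have hwa : w a = subgraphWeight k l := by simp [hw, haB]
  -- Edges above `a` lie outside `B` and carry subgraph weights, which vanish on oriented states.
  -- Thus only configurations satisfying the hypothesis of the recursion contribute.
  have hz : (∃ f, a < f ∧ c f ≠ none ∧ c f ≠ some 0) →
      ∏ e ∈ Finset.univ.erase a, w e (c e) = 0 := by
    rintro ⟨f, haf, hf0, hf1⟩
    refine Finset.prod_eq_zero (i := f) (by simp [haf.ne']) ?_
    have : f ∉ B := fun h => (ha f h).not_gt haf
    simp only [hw, this, if_false]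
    cases hcf : c f with
    | none => exact absurd hcf hf0
    | some s =>
      have : s ≠ 0 := by rintro rfl; exact hf1 hcf
      simp [subgraphWeight, this]
  simp only [h1, h2, hwa, Finset.mem_insert_self, if_true]
  generalize ∏ e ∈ Finset.univ.erase a, w e (c e) = P at hz ⊢
  by_cases hc : ∀ f, a < f → c f = none ∨ c f = some 0
  · have hI := indicator_update_pos_add_neg (tail := tail) (head := head) hc
    have hsum : ∀ f : SignType → ℚ, ∑ s, f s = f 0 + f (-1) + f 1 := fun f => by
      rw [show (Finset.univ : Finset SignType) = {0, -1, 1} from rfl, Finset.sum_insert (by decide),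
        Finset.sum_pair (by decide), add_assoc]
    simp only [Fintype.sum_option, hsum, chromaticWeight, subgraphWeight,
      show (-1 : SignType) ≠ 0 by decide, show (1 : SignType) ≠ 0 by decide, if_true, if_false]
    linear_combination k * P * hI
  · push Not at hc
    simp only [hz hc, mul_zero, zero_mul]

theorem minimalConfigSum_univ :
    minimalConfigSum tail head k l Finset.univ = minimalConfigSum tail head k l ∅ := by
  induction (Finset.univ : Finset E) using Finset.induction_on_max with
  | empty => rfl
  | insert a s ha ih => rw [minimalConfigSum_insert tail head k l ha, ih]

open Classical in
theorem minimalConfigSum_univ_eq :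
    minimalConfigSum tail head k l Finset.univ =
      ∑ O : E → SignType, (∏ e, if O e = 0 then l else k) *
        if IsMinimalConfig tail head (fun e => some (O e)) then 1 else 0 := by
  unfold minimalConfigSum
  symm
  refine Finset.sum_of_injOn (fun (O : E → SignType) e => some (O e)) ?_ (by simp) ?_ ?_
  · intro O _ O' _ h
    funext e
    exact Option.some_injective _ (congrFun h e)
  · intro c _ hc
    obtain ⟨e, he⟩ : ∃ e, c e = none := by
      by_contra! hne
      choose O hO using fun e => Option.ne_none_iff_exists'.1 (hne e)
      exact hc ⟨O, by simp, by funext e; exact (hO e).symm⟩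
    rw [Finset.prod_eq_zero (Finset.mem_univ e) (by simp [he, chromaticWeight]), zero_mul]
  · intro O _
    simp [chromaticWeight]

open Classical in
theorem minimalConfigSum_empty_eq :
    minimalConfigSum tail head k l ∅ =
      ∑ S : Finset E, ((k + l) ^ S.card * k ^ (Fintype.card E - S.card)) *
        if ∀ X : Set V, X.Nonempty → Xᶜ.Nonempty → ∃ e ∈ S, Crosses tail head X e
        then 1 else 0 := by
  unfold minimalConfigSum
  symm
  refine Finset.sum_of_injOn (fun (S : Finset E) e => if e ∈ S then some 0 else none) ?_ (by simp)
    ?_ ?_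
  · intro S _ S' _ h
    ext e
    have := congrFun h e
    by_cases h1 : e ∈ S <;> by_cases h2 : e ∈ S' <;> simp_all
  · intro c _ hc
    obtain ⟨e, he, he'⟩ : ∃ e, c e ≠ none ∧ c e ≠ some 0 := by
      by_contra! hne
      refine hc ⟨Finset.univ.filter fun e => c e = some 0, by simp, ?_⟩
      funext e
      by_cases h : c e = some 0
      · simp [h]
      · have : c e = none := by by_contra h'; exact h (hne e h')
        simp [this]
    rw [Finset.prod_eq_zero (Finset.mem_univ e), zero_mul]
    cases hce : c e with
    | none => exact absurd hce he
    | some s =>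
      have : s ≠ 0 := by rintro rfl; exact he' hce
      simp [subgraphWeight, this]
  · intro S _
    have hprod : ∏ e, (if e ∈ (∅ : Finset E) then chromaticWeight k l else subgraphWeight k l)
        (if e ∈ S then some 0 else none) = (k + l) ^ S.card * k ^ (Fintype.card E - S.card) := by
      have : ∀ e, (if e ∈ (∅ : Finset E) then chromaticWeight k l else subgraphWeight k l)
          (if e ∈ S then some 0 else none) = if e ∈ S then k + l else k := by
        intro e
        by_cases he : e ∈ S <;> simp [he, subgraphWeight]
      simp only [this]
      rw [Finset.prod_ite, Finset.prod_const, Finset.prod_const, Finset.filter_mem_eq_inter,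
        Finset.univ_inter, ← Finset.card_compl]
      congr 3
      ext e; simp
    rw [hprod]
    congr 2
    -- No edge is oriented, so no positive minimum exists: minimality means that there is no
    -- directed cut at all, i.e. `S` meets every cut.
    refine propext ⟨fun h X hX => ?_, fun h X h1 h2 => ?_⟩
    · obtain ⟨e, he, heX⟩ := h X hX.1 hX.2.1
      exact absurd heX (hX.not_crosses_of_eq_zero (by simp [he]))
    · by_contra! hne
      obtain ⟨e, he, -⟩ := h X ⟨h1, h2, fun e he heX => absurd heX (hne e (by
        by_contra heS; simp [heS] at he))⟩
      by_cases heS : e ∈ S <;> simp [heS] at he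

end WeightedSum

/-! ### Translation to graphs, counting, and the Tutte polynomial. -/

section GraphSums

variable {α β : Type*} {G : Graph α β}

theorem isLink_iff_orientation (A : Orientation G) {e : E(G)} {u v : V(G)} :
    G.IsLink e u v ↔
      (A.tail e = u ∧ A.head e = v) ∨ (A.tail e = v ∧ A.head e = u) := by
  rw [(A.isLink e).isLink_iff, Subtype.coe_inj, Subtype.coe_inj, Subtype.coe_inj, Subtype.coe_inj]

theorem mem_cutEdges_iff (A : Orientation G) {X : Set V(G)} {e : E(G)} :
    e ∈ cutEdges G X ↔ Crosses A.tail A.head X e := by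
  simp only [cutEdges, Set.mem_ofPred_eq, isLink_iff_orientation A, Crosses]
  constructor
  · rintro ⟨u, hu, v, hv, ⟨rfl, rfl⟩ | ⟨rfl, rfl⟩⟩ <;> tauto
  · intro h
    by_cases ht : A.tail e ∈ X
    · exact ⟨_, ht, A.head e, by tauto, Or.inl ⟨rfl, rfl⟩⟩
    · exact ⟨A.head e, by tauto, _, ht, Or.inr ⟨rfl, rfl⟩⟩

theorem exists_isArc_iff (A : Orientation G) (O : PartialOrientation G) {X : Set V(G)} {e : E(G)} :
    (∃ u ∈ X, ∃ v ∉ X, IsArc A O e u v) ↔ Leaves A.tail A.head (some (O e)) X e := by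
  simp only [IsArc, Leaves, Option.some_inj]
  constructor
  · rintro ⟨u, hu, v, hv, ⟨h, rfl, rfl⟩ | ⟨h, rfl, rfl⟩⟩ <;> tauto
  · rintro (⟨h, h1, h2⟩ | ⟨h, h1, h2⟩)
    · exact ⟨_, h1, _, h2, Or.inl ⟨h, rfl, rfl⟩⟩
    · exact ⟨_, h1, _, h2, Or.inr ⟨h, rfl, rfl⟩⟩

theorem isDirectedCut_iff (A : Orientation G) (O : PartialOrientation G) (X : Set V(G)) :
    IsDirectedCut A O X ↔ IsOutCut A.tail A.head (fun e => some (O e)) X := by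
  simp only [IsDirectedCut, IsOutCut, mem_cutEdges_iff A, exists_isArc_iff, ne_eq, reduceCtorEq,
    not_false_eq_true, forall_const]

/-- A spanning subgraph is connected if and only if it has an edge in every cut. -/
theorem spanning_connected_iff [Nonempty V(G)] (A : Orientation G) (S : Set E(G)) :
    (spanning G S).Connected ↔
      ∀ X : Set V(G), X.Nonempty → Xᶜ.Nonempty → ∃ e ∈ S, Crosses A.tail A.head X e := by
  constructor
  · rintro h X ⟨u, hu⟩ ⟨v, hv⟩
    obtain ⟨p⟩ := h.preconnected u v
    obtain ⟨d, -, h1, h2⟩ := p.exists_boundary_dart X hu hv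
    obtain ⟨-, ⟨e, he, hl⟩ | ⟨e, he, hl⟩⟩ := (SimpleGraph.fromRel_adj _ _ _).1 d.adj
    · exact ⟨e, he, (mem_cutEdges_iff A).1 ⟨_, h1, _, h2, hl⟩⟩
    · exact ⟨e, he, (mem_cutEdges_iff A).1 ⟨_, h1, _, h2, hl.symm⟩⟩
  · intro h
    refine (SimpleGraph.connected_iff _).2 ⟨fun u v => ?_, inferInstance⟩
    by_contra hv
    obtain ⟨e, he, hX⟩ := h {w | (spanning G S).Reachable u w} ⟨u, SimpleGraph.Reachable.refl u⟩
      ⟨v, hv⟩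
    obtain ⟨a, ha, b, hb, hl⟩ := (mem_cutEdges_iff A).2 hX
    have hab : (spanning G S).Adj a b :=
      (SimpleGraph.fromRel_adj _ _ _).2 ⟨by rintro rfl; exact hb ha, Or.inl ⟨e, he, hl⟩⟩
    exact hb (SimpleGraph.Reachable.trans ha hab.reachable)

/-- Connectedness makes every cut nonempty, so a minimum edge exists as `HasPositiveMin` demands;
`IsCutMinimal` alone holds vacuously on an empty cut. -/
theorem isCutMinimal_iff [Finite E(G)] [LinearOrder E(G)] (hG : IsConnected G) (A : Orientation G)
    (O : PartialOrientation G) :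
    IsCutMinimal A O ↔ IsMinimalConfig A.tail A.head (fun e => some (O e)) := by
  have := hG.nonempty
  simp only [IsCutMinimal, IsMinimalConfig, isDirectedCut_iff]
  refine forall_congr' fun X => ⟨fun h hX => ?_, fun h hX e he => ?_⟩
  · obtain ⟨e, -, he⟩ := (spanning_connected_iff A Set.univ).1 hG X hX.1 hX.2.1
    have hne : (cutEdges G X).Nonempty := ⟨e, (mem_cutEdges_iff A).2 he⟩
    obtain ⟨f, hf, hmin⟩ := (cutEdges G X).toFinite.exists_minimal hne
    have hle : ∀ g ∈ cutEdges G X, f ≤ g := fun g hg => (le_total f g).elim id (hmin hg)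
    exact ⟨f, congrArg some (h hX f ⟨hf, fun g hg => hle g hg⟩), (mem_cutEdges_iff A).1 hf,
      fun g hg _ => hle g ((mem_cutEdges_iff A).2 hg)⟩
  · obtain ⟨f, hf, hfX, hmin⟩ := h hX
    have : e = f := le_antisymm (he.2 ((mem_cutEdges_iff A).2 hfX))
      (hmin e ((mem_cutEdges_iff A).1 he.1) (by simp))
    exact this ▸ Option.some_injective _ hf

variable [Fintype E(G)]

theorem card_subtype_chromatic [DecidableEq E(G)] (k l : ℕ) (P : (E(G) → SignType) → Prop)
    [DecidablePred P] :
    Nat.card {C : ChromaticPartialOrientation G k l // P C.orientation} =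
      ∑ O : E(G) → SignType, (∏ e, if O e = 0 then l else k) * if P O then 1 else 0 := by
  let f : {C : ChromaticPartialOrientation G k l // P C.orientation} ≃
      Σ O : {O : E(G) → SignType // P O}, ∀ e, Fin (if O.1 e = 0 then l else k) :=
    { toFun := fun C => ⟨⟨C.1.orientation, C.2⟩, C.1.color⟩
      invFun := fun C => ⟨⟨C.1.1, C.2⟩, C.1.2⟩
      left_inv := fun _ => rfl
      right_inv := fun _ => rfl }
  rw [Nat.card_congr f, Nat.card_sigma]
  simp only [Nat.card_pi, Nat.card_fin, mul_ite, mul_one, mul_zero]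
  rw [← Finset.sum_filter]
  exact (Finset.sum_subtype (f := fun O : E(G) → SignType => ∏ e, if O e = 0 then l else k)
    (Finset.univ.filter P) (by simp)).symm

open Classical in
/-- The sum of `a ^ |S| * b ^ (m - |S|)` over the edge sets of connected spanning subgraphs. -/
noncomputable def connectedSum (G : Graph α β) [Fintype E(G)] (a b : ℚ) : ℚ :=
  ∑ S : Finset E(G), if (spanning G (S : Set E(G))).Connected then
    a ^ S.card * b ^ (Fintype.card E(G) - S.card) else 0

theorem numCutMinimal_eq [LinearOrder E(G)] (hG : IsConnected G) (A : Orientation G) (k l : ℕ) :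
    (numCutMinimal G A k l : ℚ) = connectedSum G (k + l) k := by
  let : DecidablePred fun O : E(G) → SignType => IsCutMinimal A O := Classical.decPred _
  have := hG.nonempty
  have h := minimalConfigSum_univ A.tail A.head (k : ℚ) l
  rw [minimalConfigSum_univ_eq, minimalConfigSum_empty_eq] at h
  have hcard : numCutMinimal G A k l = _ :=
    card_subtype_chromatic k l fun O => IsCutMinimal A O
  rw [hcard]
  push_cast
  refine Eq.trans (Finset.sum_congr rfl fun O _ => ?_) (h.trans (Finset.sum_congr rfl fun S _ => ?_))
  · classical exact congrArg _ (if_congr (isCutMinimal_iff hG A O) rfl rfl)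
  · rw [mul_ite, mul_one, mul_zero]
    classical exact if_congr (spanning_connected_iff A (S : Set E(G))).symm rfl rfl

theorem card_chromatic (k l : ℕ) :
    Nat.card (ChromaticPartialOrientation G k l) = (2 * k + l) ^ Fintype.card E(G) := by
  classical
  have h := card_subtype_chromatic (G := G) k l fun _ => True
  rw [Nat.card_congr (Equiv.subtypeUnivEquiv fun _ => trivial)] at h
  rw [h]
  simp only [if_true, mul_one]
  rw [← Fintype.prod_sum (fun (_ : E(G)) (s : SignType) => if s = 0 then l else k)]
  rw [show (Finset.univ : Finset SignType) = {0, -1, 1} from rfl]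
  simp
  ring

theorem reliability_eval (p : ℚ) : (reliability G).eval p = connectedSum G (1 - p) p := by
  simp [reliability, connectedSum, Polynomial.eval_finsetSum, apply_ite (Polynomial.eval p)]

variable [Fintype V(G)]

/-- Choosing an edge of `S` for each adjacent pair is injective. The bound makes the truncated
subtractions in the rank and genus exponents exact. -/
theorem card_le_of_spanning_connected {S : Finset E(G)}
    (h : (spanning G (S : Set E(G))).Connected) : numVertices G ≤ S.card + 1 := by
  classical
  refine h.card_vert_le_card_edgeSet_add_one.trans (Nat.add_le_add_right ?_ 1)
  have hex : ∀ x : (spanning G (S : Set E(G))).edgeSet, ∃ e : S, ∃ u v : V(G),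
      G.IsLink (e : E(G)) u v ∧ x.1 = s(u, v) := by
    rintro ⟨x, hx⟩
    induction x using Sym2.ind with
    | _ u v =>
      obtain ⟨-, ⟨e, he, hl⟩ | ⟨e, he, hl⟩⟩ :=
        (SimpleGraph.fromRel_adj _ _ _).1 ((SimpleGraph.mem_edgeSet _).1 hx)
      · exact ⟨⟨e, he⟩, u, v, hl, rfl⟩
      · exact ⟨⟨e, he⟩, u, v, hl.symm, rfl⟩
  choose f hf using hex
  have hinj : Function.Injective f := by
    intro x y hxy
    obtain ⟨u, v, hl, hx⟩ := hf x
    obtain ⟨u', v', hl', hy⟩ := hf y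
    rw [hxy] at hl
    apply Subtype.ext
    rw [hx, hy]
    rcases hl.eq_and_eq_or_eq_and_eq hl' with ⟨h1, h2⟩ | ⟨h1, h2⟩
    · rw [Subtype.ext h1, Subtype.ext h2]
    · rw [Subtype.ext h1, Subtype.ext h2, Sym2.eq_swap]
  simpa using Nat.card_le_card_of_injective f hinj

omit [Fintype E(G)] [Fintype V(G)] in
theorem numComponents_eq_one_iff [Nonempty V(G)] (S : Set E(G)) :
    numComponents G S = 1 ↔ (spanning G S).Connected := by
  rw [numComponents, Nat.card_eq_one_iff_unique]
  constructor
  · rintro ⟨h, -⟩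
    exact (SimpleGraph.connected_iff _).2
      ⟨fun u v => SimpleGraph.ConnectedComponent.exact (h.elim _ _), inferInstance⟩
  · intro h
    exact ⟨h.preconnected.subsingleton_connectedComponent, inferInstance⟩

omit [Fintype E(G)] in
theorem numComponents_pos [Nonempty V(G)] (S : Set E(G)) : 0 < numComponents G S :=
  Nat.card_pos

omit [Fintype E(G)] in
theorem numComponents_le (S : Set E(G)) : numComponents G S ≤ numVertices G :=
  Nat.card_le_card_of_surjective (spanning G S).connectedComponentMk Quot.mk_surjective

theorem connectedSum_eq_tutteEval (hG : IsConnected G) {a b : ℚ} (hb : b ≠ 0) {y : ℚ}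
    (hy : y = a / b + 1) :
    connectedSum G a b = a ^ (numVertices G - 1) * b ^ genus G * tutteEval G 1 y := by
  classical
  have := hG.nonempty
  have hcard : numEdges G = Fintype.card E(G) := Nat.card_eq_fintype_card
  have hV : 0 < numVertices G := Nat.card_pos
  have huniv : numComponents G Set.univ = 1 := (numComponents_eq_one_iff _).2 hG
  simp only [connectedSum, tutteEval, tutte, map_sum, Finset.mul_sum]
  refine Finset.sum_congr rfl fun S _ => ?_
  simp only [map_mul, map_pow, map_sub, MvPolynomial.aeval_X, map_one, Matrix.cons_val_zero,
    Matrix.cons_val_one, sub_self, rank, huniv]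
  split_ifs with hS
  · have h1 := (numComponents_eq_one_iff _).2 hS
    have h2 := card_le_of_spanning_connected hS
    have h3 : S.card ≤ Fintype.card E(G) := S.card_le_univ
    -- With nullity `i` and `j` missing edges, `g = i + j` and `a^|S| b^j = a^(n-1) b^g (a/b)^i`.
    obtain ⟨i, hi⟩ : ∃ i, S.card = numVertices G - 1 + i := ⟨S.card - (numVertices G - 1), by lia⟩
    obtain ⟨j, hj⟩ : ∃ j, Fintype.card E(G) = S.card + j := ⟨_, (Nat.add_sub_of_le h3).symm⟩
    have hg : genus G = i + j := by rw [genus, hcard]; lia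
    have hi' : S.card - (numVertices G - 1) = i := by lia
    have hj' : Fintype.card E(G) - S.card = j := by lia
    rw [h1, hi', hj', hg, hy, hi, Nat.sub_self, pow_zero, add_sub_cancel_right, div_pow]
    field_simp
    ring
  · have h1 : numComponents G S ≠ 1 := fun h => hS ((numComponents_eq_one_iff _).1 h)
    have h2 := numComponents_pos (G := G) (S : Set E(G))
    have h3 := numComponents_le (G := G) (S : Set E(G))
    -- Since `1 < c(S) ≤ n`, the exponent of `x - 1 = 0` is positive.
    rw [zero_pow (by lia)]
    simp

/-- The sum is homogeneous of degree `m` in its two arguments. -/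
theorem connectedSum_div (a b c : ℚ) :
    connectedSum G (a / c) (b / c) = connectedSum G a b / c ^ Fintype.card E(G) := by
  classical
  simp only [connectedSum, Finset.sum_div]
  refine Finset.sum_congr rfl fun S _ => ?_
  split_ifs
  · rw [div_pow, div_pow, div_mul_div_comm, ← pow_add, Nat.add_sub_of_le S.card_le_univ]
  · simp

end GraphSums
end TutteOrientation

open TutteOrientation in
theorem theorem8 {α β : Type*} (G : Graph α β) [Fintype V(G)] [Fintype E(G)]
    (hG : IsConnected G) [LinearOrder E(G)] (A : Orientation G)
    (p : ℚ) (hp0 : 0 < p) (hp1 : p < 1 / 2) :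
    (∃ k l : ℕ, 0 < k ∧ 0 < l ∧ p = (k : ℚ) / (2 * k + l)) ∧
    (reliability G).eval p =
      (1 - p) ^ (numVertices G - 1) * p ^ genus G * tutteEval G 1 (1 / p) ∧
    ∀ k l : ℕ, 0 < k → 0 < l → p = (k : ℚ) / (2 * k + l) →
      (numCutMinimal G A k l : ℚ) =
        ((k : ℚ) + l) ^ (numVertices G - 1) * (k : ℚ) ^ genus G *
          tutteEval G 1 ((2 * k + l) / k) ∧
      (reliability G).eval p = probCutMinimal G A k l := by
  refine ⟨?_, ?_, fun k l hk hl hp => ⟨?_, ?_⟩⟩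
  · have hnum : 0 < p.num := Rat.num_pos.2 hp0
    have hden : (0 : ℚ) < p.den := by exact_mod_cast p.den_pos
    have hpd : p = p.num / p.den := (Rat.num_div_den p).symm
    have hlt : 2 * p.num < p.den := by
      rw [hpd, div_lt_div_iff₀ hden two_pos] at hp1
      have : (2 * p.num : ℚ) < p.den := by linarith
      exact_mod_cast this
    -- `k` is the numerator of `p`, and `l` makes `2k + l` its denominator; `l > 0` because `p <
    -- 1/2`.
    refine ⟨p.num.toNat, (p.den - 2 * p.num).toNat, by lia, by lia, ?_⟩
    have h1 : ((p.num.toNat : ℕ) : ℚ) = p.num := by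
      exact_mod_cast Int.toNat_of_nonneg hnum.le
    have h2 : (((p.den - 2 * p.num).toNat : ℕ) : ℚ) = p.den - 2 * p.num := by
      exact_mod_cast Int.toNat_of_nonneg (sub_pos.2 hlt).le
    rw [h1, h2, add_sub_cancel]
    exact hpd
  · rw [reliability_eval, connectedSum_eq_tutteEval hG hp0.ne']
    field_simp
    ring
  · have hk' : (k : ℚ) ≠ 0 := by exact_mod_cast hk.ne'
    rw [numCutMinimal_eq hG, connectedSum_eq_tutteEval hG hk']
    field_simp
    ring
  · have hc : (2 * k + l : ℚ) ≠ 0 := by positivity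
    have h1p : 1 - p = (k + l) / (2 * k + l) := by rw [hp]; field_simp; ring
    rw [reliability_eval, probCutMinimal, numCutMinimal_eq hG, card_chromatic, h1p, hp,
      connectedSum_div]
    push_cast
    rfl
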